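/- For a real $m\times n$ matrix $X$ with singular values $\sigma_1(X)\ge\sigma_2(X)\ge\cdots\ge 0$ (where $\sigma_i(X)=0$ for $i>\min(m,n)$) and a real number $q>0$, let $\|X\|_{S_q}=\bigl(\sum_{i}\sigma_i(X)^q\bigr)^{1/q}$ be its Schatten-$q$ norm (a quasi-norm for $q<1$). Theorem. Let $X\in\mathbb{R}^{m\times n}$ with $r=\operatorname{rank}(X)\le d$, let $0<p\le 1$, and let $p_1,p_2>0$ satisfy $1/p_1+1/p_2=1/p$. Then $X$ can be written as $X=UV^T$ with $U\in\mathbb{R}^{m\times d}$, $V\in\mathbb{R}^{n\times d}$, and $$\|X\|_{S_p}=\min_{U\in\mathbb{R}^{m\times d},\;V\in\mathbb{R}^{n\times d}:\;X=UV^T}\|U\|_{S_{p_1}}\|V\|_{S_{p_2}}.$$ Moreover, let $\Sigma_X=\operatorname{diag}(\sigma_1(X),\dots,\sigma_d(X))\in\mathbb{R}^{d\times d}$. There are $L_X\in\mathbb{R}^{m\times d}$ and $R_X\in\mathbb{R}^{n\times d}$ such that $X=L_X\Sigma_XR_X^T$, the first $r$ columns of $L_X$ are orthonormal, and the first $r$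 columns of $R_X$ are orthonormal; if $d\le\min(m,n)$, they can be chosen with $L_X^TL_X=R_X^TR_X=I_d$. For all $L_X,R_X$ such that $X=L_X\Sigma_XR_X^T$ and the first $r$ columns of each are orthonormal, the minimum is attained at $U=L_X\Sigma_X^{p/p_1}$, $V=R_X\Sigma_X^{p/p_2}$, where powers of $\Sigma_X$ are taken entrywise. -/

import Mathlib

open scoped Matrix

noncomputable section

namespace SchattenFactorization

/-- The singular values of a real `m × n` matrix, with multiplicity, in nonincreasing order and
indexed from `0`: the singular values of the linear map `x ↦ X x` between Euclidean spaces.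
The value is `0` for every index `i` with `min m n ≤ i`. -/
def singularValue {m n : ℕ} (X : Matrix (Fin m) (Fin n) ℝ) (i : ℕ) : ℝ :=
  (Matrix.toEuclideanLin X).singularValues i

/-- The Schatten-`p` norm (a quasi-norm for `p < 1`), for real `p > 0`:
`‖X‖_{S_p} = (∑ σ_i(X) ^ p) ^ (1 / p)`. If `m < n`, the surplus terms vanish. -/
def schattenNorm {m n : ℕ} (p : ℝ) (X : Matrix (Fin m) (Fin n) ℝ) : ℝ :=
  (∑ i ∈ Finset.range n, singularValue X i ^ p) ^ (1 / p)

/-- The `d × d` diagonal matrix `Σ_X ^ q` of the `q`-th powers of the top `d` singular values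
of `X` (entrywise power, `q > 0`). -/
def sigmaPow {m n : ℕ} (d : ℕ) (X : Matrix (Fin m) (Fin n) ℝ) (q : ℝ) :
    Matrix (Fin d) (Fin d) ℝ :=
  Matrix.diagonal fun i => singularValue X i ^ q

/-- `X = L Σ_X Rᵀ` is a singular value decomposition of `X` truncated to the top `d` singular
values. The first `rank X` columns of `L` and of `R`, those belonging to nonzero singular values,
are orthonormal. Nothing is asked of the other columns, which meet the zero entries of `Σ_X`; so
`d` may exceed `m` and `n`, and zero padding is allowed. -/
structure IsTruncatedSVD {m n d : ℕ} (X : Matrix (Fin m) (Fin n) ℝ)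
    (L : Matrix (Fin m) (Fin d) ℝ) (R : Matrix (Fin n) (Fin d) ℝ) : Prop where
  eq_mul : X = L * Matrix.diagonal (fun i : Fin d => singularValue X i) * Rᵀ
  left_orthonormal : ∀ i j : Fin d, (i : ℕ) < X.rank → (j : ℕ) < X.rank →
    (Lᵀ * L) i j = if i = j then 1 else 0
  right_orthonormal : ∀ i j : Fin d, (i : ℕ) < X.rank → (j : ℕ) < X.rank →
    (Rᵀ * R) i j = if i = j then 1 else 0

end SchattenFactorization

end

/-!
Singular values obey the min-max principle: `c ≤ σᵢ(T)` as soon as `T` expands the norm by at least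
`c` on some subspace of dimension `> i`, and the value `c = σᵢ(T)` is reached on the span of the
first `i + 1` right singular vectors (`LinearMap.le_singularValues`,
`LinearMap.exists_singularValues_mul_norm_le`). It follows that restricting `T` to a subspace does
not increase singular values, and that `T` and its adjoint have the same singular values.

The lower bound rests on Horn's inequality `∏_{i<k} σᵢ(T S) ≤ ∏_{i<k} σᵢ(T) σᵢ(S)`
(`LinearMap.prod_singularValues_comp_le`). Let `p` be the span of the first `k` right singular
vectors of `T S`. The left-hand side is the volume factor
(`LinearMap.normDet`) of `T S` on `p`, which is the volume
factor of `S` on `p` times that of `T` on `S p`, and by monotonicity under restriction the volume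
factor of a map on a `k`-dimensional subspace is at most the product of its first `k` singular
values. The passage from products to sums of `p`-th powers is summation by parts together with
`exp t ≥ 1 + t` (`SchattenFactorization.sum_rpow_le_sum_rpow_of_prod_le`), and Hölder's inequality
then separates `U` from `V`.

For attainment, the columns of `L Σ_X ^ (p / p₁)` are orthogonal with norms `σᵢ(X) ^ (p / p₁)`,
which are therefore the singular values of that matrix; likewise for `R Σ_X ^ (p / p₂)`. So both
Schatten norms are powers of the same sum `∑ σᵢ(X) ^ p`, with exponents adding up to `1 / p`. A
truncated singular value decomposition is built from the eigenvectors of `Xᵀ X` and an orthonormal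
extension of their normalised images.
-/

open scoped Matrix

noncomputable section

namespace LinearMap

open Module

/-! ### Bases of right singular vectors -/

variable {E F G : Type*} [NormedAddCommGroup E] [InnerProductSpace ℝ E]
  [NormedAddCommGroup F] [InnerProductSpace ℝ F] [NormedAddCommGroup G] [InnerProductSpace ℝ G]

/-- `b` is an orthonormal basis of right singular vectors of `T`: its image under `T` is orthogonal,
and `‖T (b i)‖ = s i` with `s` nonnegative and nonincreasing on `i < n`. The values of `s` at
indices `≥ n` are irrelevant. -/
structure IsSingularBasis {n : ℕ} (T : E →ₗ[ℝ] F) (b : OrthonormalBasis (Fin n) ℝ E)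
    (s : ℕ → ℝ) : Prop where
  antitone : ∀ i j : Fin n, i ≤ j → s j ≤ s i
  nonneg : ∀ i : Fin n, 0 ≤ s i
  inner_apply : ∀ i j : Fin n, inner ℝ (T (b i)) (T (b j)) = if i = j then s i ^ 2 else 0

namespace IsSingularBasis

variable {n : ℕ} {T : E →ₗ[ℝ] F} {b : OrthonormalBasis (Fin n) ℝ E} {s : ℕ → ℝ}

theorem norm_sq_apply (h : T.IsSingularBasis b s) (x : E) :
    ‖T x‖ ^ 2 = ∑ i : Fin n, s i ^ 2 * inner ℝ (b i) x ^ 2 := by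
  conv_lhs => rw [← b.sum_repr' x, map_sum, ← real_inner_self_eq_norm_sq]
  simp only [map_smul, sum_inner, inner_sum, inner_smul_left, inner_smul_right, h.inner_apply,
    mul_ite, mul_zero]
  exact Finset.sum_congr rfl fun i _ => by simp; ring

theorem le_norm_apply (h : T.IsSingularBasis b s) (i : Fin n) {x : E}
    (hx : ∀ j, i < j → inner ℝ (b j) x = 0) : s i * ‖x‖ ≤ ‖T x‖ := by
  refine le_of_sq_le_sq ?_ (norm_nonneg _)
  rw [mul_pow, h.norm_sq_apply, ← b.sum_sq_inner_right x, Finset.mul_sum]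
  refine Finset.sum_le_sum fun j _ => ?_
  rcases lt_or_ge i j with hij | hij
  · simp [hx j hij]
  · exact mul_le_mul_of_nonneg_right
      (pow_le_pow_left₀ (h.nonneg i) (h.antitone j i hij) 2) (sq_nonneg _)

theorem norm_apply_le (h : T.IsSingularBasis b s) (i : Fin n) {x : E}
    (hx : ∀ j, j < i → inner ℝ (b j) x = 0) : ‖T x‖ ≤ s i * ‖x‖ := by
  refine le_of_sq_le_sq ?_ (mul_nonneg (h.nonneg i) (norm_nonneg _))
  rw [mul_pow, h.norm_sq_apply, ← b.sum_sq_inner_right x, Finset.mul_sum]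
  refine Finset.sum_le_sum fun j _ => ?_
  rcases lt_or_ge j i with hij | hij
  · simp [hx j hij]
  · exact mul_le_mul_of_nonneg_right
      (pow_le_pow_left₀ (h.nonneg j) (h.antitone i j hij) 2) (sq_nonneg _)

/-- Half of the min-max principle: a lower bound for `T` on a subspace of dimension `> i` bounds
`s i` from below. -/
theorem le_of_forall_le_norm_apply (h : T.IsSingularBasis b s) {W : Submodule ℝ E} {i : ℕ}
    (hW : i < finrank ℝ W) {c : ℝ} (hc : ∀ x ∈ W, c * ‖x‖ ≤ ‖T x‖) : c ≤ s i := by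
  have hn : finrank ℝ E = n := by simpa using finrank_eq_card_basis b.toBasis
  have : FiniteDimensional ℝ E := b.toBasis.finiteDimensional_of_finite
  have hin : i < n := hW.trans_le (hn ▸ W.finrank_le)
  -- A nonzero vector of `W` that is orthogonal to the first `i` basis vectors.
  let f : W →ₗ[ℝ] (Fin i → ℝ) :=
    LinearMap.pi fun j => (innerₛₗ ℝ (b ⟨j, j.2.trans hin⟩)) ∘ₗ W.subtype
  obtain ⟨x, hx, hx0⟩ := (Submodule.ne_bot_iff _).1
    (f.ker_ne_bot_of_finrank_lt (by simpa using hW))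
  have hxi : ‖T x‖ ≤ s i * ‖(x : E)‖ := h.norm_apply_le ⟨i, hin⟩ fun j hj => by
    simpa [f] using congrFun (mem_ker.1 hx) ⟨j, hj⟩
  exact le_of_mul_le_mul_right ((hc x x.2).trans hxi) (by simpa using hx0)

end IsSingularBasis

/-- The span of the vectors `b j` with `j < k`, a subspace of dimension `min k n`. -/
def leadingSpan {n : ℕ} (b : OrthonormalBasis (Fin n) ℝ E) (k : ℕ) : Submodule ℝ E :=
  Submodule.span ℝ (b '' {j | (j : ℕ) < k})

theorem finrank_leadingSpan {n : ℕ} (b : OrthonormalBasis (Fin n) ℝ E) {k : ℕ} (hk : k ≤ n) :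
    finrank ℝ (leadingSpan b k) = k := by
  have : b '' {j | (j : ℕ) < k} = Set.range fun j : Fin k => b (Fin.castLE hk j) := by
    ext x
    constructor
    · rintro ⟨j, hj, rfl⟩
      exact ⟨⟨j, hj⟩, rfl⟩
    · rintro ⟨j, rfl⟩
      exact ⟨_, j.2, rfl⟩
  rw [leadingSpan, this, finrank_span_eq_card, Fintype.card_fin]
  exact b.orthonormal.linearIndependent.comp _ (Fin.castLE_injective hk)

theorem inner_eq_zero_of_mem_leadingSpan {n : ℕ} {b : OrthonormalBasis (Fin n) ℝ E} {k : ℕ}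
    {x : E} (hx : x ∈ leadingSpan b k) {j : Fin n} (hj : k ≤ j) : inner ℝ (b j) x = 0 := by
  have : leadingSpan b k ≤ (innerₛₗ ℝ (b j)).ker := by
    refine Submodule.span_le.2 ?_
    rintro _ ⟨i, hi, rfl⟩
    have hij : j ≠ i := by
      rintro rfl
      exact absurd hi (not_lt.2 hj)
    simp [hij]
  exact this hx

theorem leadingSpan_mono {n : ℕ} (b : OrthonormalBasis (Fin n) ℝ E) {k l : ℕ} (h : k ≤ l) :
    leadingSpan b k ≤ leadingSpan b l :=
  Submodule.span_mono (Set.image_mono fun _ hj => lt_of_lt_of_le hj h)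

theorem IsSingularBasis.le_norm_apply_of_mem_leadingSpan {n : ℕ} {T : E →ₗ[ℝ] F}
    {b : OrthonormalBasis (Fin n) ℝ E} {s : ℕ → ℝ} (h : T.IsSingularBasis b s) {i : ℕ}
    (hi : i < n) {x : E} (hx : x ∈ leadingSpan b (i + 1)) : s i * ‖x‖ ≤ ‖T x‖ :=
  h.le_norm_apply ⟨i, hi⟩ fun _ hj => inner_eq_zero_of_mem_leadingSpan hx hj

/-! ### The min-max principle for singular values -/

variable [FiniteDimensional ℝ E] [FiniteDimensional ℝ F] [FiniteDimensional ℝ G]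

theorem exists_isSingularBasis (T : E →ₗ[ℝ] F) {n : ℕ} (hn : finrank ℝ E = n) :
    ∃ b : OrthonormalBasis (Fin n) ℝ E, T.IsSingularBasis b T.singularValues := by
  refine ⟨T.isSymmetric_adjoint_comp_self.eigenvectorBasis hn,
    fun i j hij => T.singularValues_antitone hij, fun i => T.singularValues_nonneg i,
    fun i j => ?_⟩
  rw [← adjoint_inner_right, ← comp_apply, IsSymmetric.apply_eigenvectorBasis,
    inner_smul_right, OrthonormalBasis.inner_eq_ite, ← T.sq_singularValues_fin hn]
  split_ifs with h <;> simp [h]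

/-- The values attached to a basis of right singular vectors are the singular values, because the
min-max principle determines them from `T` alone. -/
theorem IsSingularBasis.eq_singularValues {n : ℕ} {T : E →ₗ[ℝ] F}
    {b : OrthonormalBasis (Fin n) ℝ E} {s : ℕ → ℝ} (h : T.IsSingularBasis b s) {i : ℕ}
    (hi : i < n) : T.singularValues i = s i := by
  obtain ⟨b', h'⟩ := T.exists_isSingularBasis (by simpa using finrank_eq_card_basis b.toBasis)
  refine le_antisymm ?_ ?_
  · exact h.le_of_forall_le_norm_apply (W := leadingSpan b' (i + 1))
      (by rw [finrank_leadingSpan _ hi]; exact i.lt_succ_self)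
      fun x hx => h'.le_norm_apply_of_mem_leadingSpan hi hx
  · exact h'.le_of_forall_le_norm_apply (W := leadingSpan b (i + 1))
      (by rw [finrank_leadingSpan _ hi]; exact i.lt_succ_self)
      fun x hx => h.le_norm_apply_of_mem_leadingSpan hi hx

theorem le_singularValues (T : E →ₗ[ℝ] F) {W : Submodule ℝ E} {i : ℕ} (hW : i < finrank ℝ W)
    {c : ℝ} (hc : ∀ x ∈ W, c * ‖x‖ ≤ ‖T x‖) : c ≤ T.singularValues i := by
  obtain ⟨b, h⟩ := T.exists_isSingularBasis rfl
  exact h.le_of_forall_le_norm_apply hW hc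

theorem exists_singularValues_mul_norm_le (T : E →ₗ[ℝ] F) {i : ℕ} (hi : i < finrank ℝ E) :
    ∃ W : Submodule ℝ E, finrank ℝ W = i + 1 ∧
      ∀ x ∈ W, T.singularValues i * ‖x‖ ≤ ‖T x‖ := by
  obtain ⟨b, h⟩ := T.exists_isSingularBasis rfl
  exact ⟨leadingSpan b (i + 1), finrank_leadingSpan b hi,
    fun x hx => h.le_norm_apply_of_mem_leadingSpan hi hx⟩

theorem singularValues_domRestrict_le (T : E →ₗ[ℝ] F) (p : Submodule ℝ E) (i : ℕ) :
    (T.domRestrict p).singularValues i ≤ T.singularValues i := by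
  rcases lt_or_ge i (finrank ℝ p) with hi | hi
  · obtain ⟨W, hW, h⟩ := (T.domRestrict p).exists_singularValues_mul_norm_le hi
    refine T.le_singularValues (W := W.map p.subtype) ?_ ?_
    · rw [Submodule.finrank_map_subtype_eq, hW]
      exact i.lt_succ_self
    · rintro _ ⟨x, hx, rfl⟩
      exact h x hx
  · rw [singularValues_of_finrank_le _ hi]
    exact T.singularValues_nonneg i

/-- If `‖T x‖ ≥ σᵢ ‖x‖` on `W`, then `‖T† y‖ ≥ σᵢ ‖y‖` on `T W`, by Cauchy-Schwarz for
`‖T x‖ ^ 2 = ⟪T† T x, x⟫`. -/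
theorem singularValues_le_adjoint (T : E →ₗ[ℝ] F) (i : ℕ) :
    T.singularValues i ≤ T.adjoint.singularValues i := by
  rcases (T.singularValues_nonneg i).eq_or_lt with h0 | h0
  · exact h0 ▸ T.adjoint.singularValues_nonneg i
  have hi : i < finrank ℝ E := by
    by_contra! hi
    exact h0.ne' (T.singularValues_of_finrank_le hi)
  obtain ⟨W, hW, h⟩ := T.exists_singularValues_mul_norm_le hi
  refine T.adjoint.le_singularValues (W := W.map T) ?_ ?_
  · have hinj : Function.Injective (T.domRestrict W) := by
      refine (injective_iff_map_eq_zero _).2 fun x hx => ?_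
      have hTx : T x = 0 := hx
      have := h x x.2
      rw [hTx, norm_zero] at this
      have hx0 : ‖(x : E)‖ = 0 := by nlinarith [norm_nonneg (x : E)]
      simpa using hx0
    rw [← range_domRestrict, finrank_range_of_inj hinj, hW]
    exact i.lt_succ_self
  · rintro _ ⟨x, hx, rfl⟩
    rcases eq_or_ne x 0 with rfl | hx0
    · simp
    have hpos : 0 < ‖x‖ := norm_pos_iff.2 hx0
    have h1 : ‖T x‖ * ‖T x‖ ≤ ‖T.adjoint (T x)‖ * ‖x‖ := by
      rw [← real_inner_self_eq_norm_mul_norm, ← adjoint_inner_left]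
      exact real_inner_le_norm _ _
    refine le_of_mul_le_mul_right (h1.trans' ?_) hpos
    nlinarith [h x hx, norm_nonneg (T x)]

theorem singularValues_adjoint (T : E →ₗ[ℝ] F) (i : ℕ) :
    T.adjoint.singularValues i = T.singularValues i := by
  refine le_antisymm ?_ (T.singularValues_le_adjoint i)
  simpa using T.adjoint.singularValues_le_adjoint i

/-! ### Horn's inequality -/

theorem normDet_domRestrict_le (T : E →ₗ[ℝ] F) (p : Submodule ℝ E) :
    (T.domRestrict p).normDet ≤ ∏ i ∈ Finset.range (finrank ℝ p), T.singularValues i := by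
  rw [normDet_eq_prod_singularValues]
  exact Finset.prod_le_prod (fun i _ => singularValues_nonneg _ i)
    fun i _ => T.singularValues_domRestrict_le p i

/-- The span of the first `k` right singular vectors reaches the bound of
`LinearMap.normDet_domRestrict_le`. -/
theorem exists_prod_singularValues_le_normDet (T : E →ₗ[ℝ] F) {k : ℕ} (hk : k ≤ finrank ℝ E) :
    ∃ p : Submodule ℝ E, finrank ℝ p = k ∧
      ∏ i ∈ Finset.range k, T.singularValues i ≤ (T.domRestrict p).normDet := by
  obtain ⟨b, h⟩ := T.exists_isSingularBasis rfl
  refine ⟨leadingSpan b k, finrank_leadingSpan b hk, ?_⟩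
  rw [normDet_eq_prod_singularValues, finrank_leadingSpan b hk]
  refine Finset.prod_le_prod (fun i _ => T.singularValues_nonneg i) fun i hi => ?_
  have hik : i + 1 ≤ k := Finset.mem_range.1 hi
  refine le_singularValues _
    (W := (leadingSpan b (i + 1)).comap (leadingSpan b k).subtype) ?_ fun x hx =>
      h.le_norm_apply_of_mem_leadingSpan (hik.trans hk) hx
  rw [(Submodule.comapSubtypeEquivOfLe (leadingSpan_mono b hik)).finrank_eq,
    finrank_leadingSpan b (hik.trans hk)]
  exact i.lt_succ_self

/-- **Horn's inequality** for the singular values of a composition. -/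
theorem prod_singularValues_comp_le (S : E →ₗ[ℝ] F) (T : F →ₗ[ℝ] G) (k : ℕ) :
    ∏ i ∈ Finset.range k, (T ∘ₗ S).singularValues i ≤
      ∏ i ∈ Finset.range k, T.singularValues i * S.singularValues i := by
  -- For `k > dim E` the left-hand side has a vanishing factor.
  rcases lt_or_ge (finrank ℝ E) k with hk | hk
  · rw [Finset.prod_eq_zero (Finset.mem_range.2 hk) (singularValues_of_finrank_le _ le_rfl)]
    exact Finset.prod_nonneg fun i _ =>
      mul_nonneg (T.singularValues_nonneg i) (S.singularValues_nonneg i)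
  obtain ⟨p, hp, h⟩ := (T ∘ₗ S).exists_prod_singularValues_le_normDet hk
  refine h.trans ?_
  rw [Finset.prod_mul_distrib, show (T ∘ₗ S).domRestrict p = T ∘ₗ S.domRestrict p from rfl,
    normDet_comp]
  have hS := S.normDet_domRestrict_le p
  rw [hp] at hS
  rcases eq_or_ne (S.domRestrict p).normDet 0 with h0 | h0
  · rw [h0, mul_zero]
    exact mul_nonneg (Finset.prod_nonneg fun i _ => T.singularValues_nonneg i)
      (Finset.prod_nonneg fun i _ => S.singularValues_nonneg i)
  -- `S` is injective on `p`, so the image `S p` again has dimension `k`.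
  have hrange : finrank ℝ (S.domRestrict p).range = k := by
    rw [ne_eq, normDet_eq_zero_iff_rank_range_ne, not_not] at h0
    exact h0.trans hp
  have hT := T.normDet_domRestrict_le (S.domRestrict p).range
  rw [hrange] at hT
  exact mul_le_mul hT hS (normDet_nonneg _)
    (Finset.prod_nonneg fun i _ => T.singularValues_nonneg i)

end LinearMap

namespace SchattenFactorization

/-! ### From products to sums of powers -/

/-- Abel's inequality for nonincreasing weights `x` and nonnegative partial sums of `d`, with the
last weight kept on the left so that induction goes through. -/
theorem mul_sum_le_sum_mul_of_antitone {x d : ℕ → ℝ} {r : ℕ} (hx : Antitone x)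
    (hd : ∀ k ≤ r + 1, 0 ≤ ∑ i ∈ Finset.range k, d i) :
    x r * ∑ i ∈ Finset.range (r + 1), d i ≤ ∑ i ∈ Finset.range (r + 1), x i * d i := by
  induction r with
  | zero => simp
  | succ r ih =>
    have h1 := ih fun k hk => hd k (hk.trans (Nat.le_succ _))
    have h2 := mul_le_mul_of_nonneg_right (hx r.le_succ) (hd (r + 1) (Nat.le_succ _))
    rw [Finset.sum_range_succ, Finset.sum_range_succ (fun i => x i * d i), mul_add]
    linarith

theorem sum_mul_nonneg_of_antitone {x d : ℕ → ℝ} {r : ℕ} (hx : Antitone x) (hx0 : ∀ i, 0 ≤ x i)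
    (hd : ∀ k ≤ r, 0 ≤ ∑ i ∈ Finset.range k, d i) :
    0 ≤ ∑ i ∈ Finset.range r, x i * d i := by
  cases r with
  | zero => simp
  | succ r =>
    exact (mul_nonneg (hx0 r) (hd _ le_rfl)).trans (mul_sum_le_sum_mul_of_antitone hx hd)

/-- Weak log-majorization implies domination of the sums of `p`-th powers. Monotonicity is needed
for `a` alone. -/
theorem sum_rpow_le_sum_rpow_of_prod_le {a b : ℕ → ℝ} {r : ℕ} {p : ℝ} (hp : 0 < p)
    (ha : Antitone a) (ha0 : ∀ i, 0 ≤ a i) (hpos : ∀ i < r, 0 < a i) (hb : ∀ i, 0 ≤ b i)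
    (h : ∀ k ≤ r, ∏ i ∈ Finset.range k, a i ≤ ∏ i ∈ Finset.range k, b i) :
    ∑ i ∈ Finset.range r, a i ^ p ≤ ∑ i ∈ Finset.range r, b i ^ p := by
  have hbpos : ∀ i < r, 0 < b i := by
    have hprod : 0 < ∏ i ∈ Finset.range r, b i :=
      (Finset.prod_pos fun i hi => hpos i (Finset.mem_range.1 hi)).trans_le (h r le_rfl)
    exact fun i hi => (hb i).lt_of_ne'
      (Finset.prod_ne_zero_iff.1 hprod.ne' i (Finset.mem_range.2 hi))
  have hd : ∀ k ≤ r, 0 ≤ ∑ i ∈ Finset.range k, (Real.log (b i) - Real.log (a i)) := by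
    intro k hk
    have hlt : ∀ i ∈ Finset.range k, i < r := fun i hi => (Finset.mem_range.1 hi).trans_le hk
    rw [Finset.sum_sub_distrib, ← Real.log_prod fun i hi => (hbpos i (hlt i hi)).ne',
      ← Real.log_prod fun i hi => (hpos i (hlt i hi)).ne', sub_nonneg]
    exact Real.log_le_log (Finset.prod_pos fun i hi => hpos i (hlt i hi)) (h k hk)
  have key := sum_mul_nonneg_of_antitone (x := fun i => a i ^ p)
    (fun i j hij => Real.rpow_le_rpow (ha0 j) (ha hij) hp.le)
    (fun i => Real.rpow_nonneg (ha0 i) p) hd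
  -- `b ^ p = a ^ p * exp (p * log (b / a)) ≥ a ^ p * (1 + p * log (b / a))`
  have hterm : ∀ i ∈ Finset.range r,
      a i ^ p + p * (a i ^ p * (Real.log (b i) - Real.log (a i))) ≤ b i ^ p := by
    intro i hi
    have hai := hpos i (Finset.mem_range.1 hi)
    have hbi := hbpos i (Finset.mem_range.1 hi)
    have hexp : b i ^ p = a i ^ p * Real.exp (p * (Real.log (b i) - Real.log (a i))) := by
      rw [Real.rpow_def_of_pos hai, Real.rpow_def_of_pos hbi, ← Real.exp_add]
      congr 1
      ring
    have := mul_le_mul_of_nonneg_left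
      (Real.add_one_le_exp (p * (Real.log (b i) - Real.log (a i)))) (Real.rpow_pos_of_pos hai p).le
    rw [hexp]
    linarith
  have := Finset.sum_le_sum hterm
  rw [Finset.sum_add_distrib, ← Finset.mul_sum] at this
  linarith [mul_nonneg hp.le key]

/-! ### Singular values and Schatten norms of matrices -/

variable {m n d : ℕ}

theorem singularValue_nonneg (X : Matrix (Fin m) (Fin n) ℝ) (i : ℕ) : 0 ≤ singularValue X i :=
  LinearMap.singularValues_nonneg _ i

theorem singularValue_antitone (X : Matrix (Fin m) (Fin n) ℝ) : Antitone (singularValue X) :=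
  LinearMap.singularValues_antitone _

theorem singularValue_pos_iff (X : Matrix (Fin m) (Fin n) ℝ) {i : ℕ} :
    0 < singularValue X i ↔ i < X.rank := by
  rw [singularValue, LinearMap.singularValues_pos_iff_lt_finrank_range,
    X.rank_eq_finrank_range_toLin (PiLp.basisFun 2 ℝ _) (PiLp.basisFun 2 ℝ _),
    ← Matrix.toLpLin_eq_toLin 2 2]

theorem singularValue_eq_zero_iff (X : Matrix (Fin m) (Fin n) ℝ) {i : ℕ} :
    singularValue X i = 0 ↔ X.rank ≤ i := by
  rw [← not_lt, ← singularValue_pos_iff, (singularValue_nonneg X i).lt_iff_ne', not_not]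

theorem singularValue_transpose (X : Matrix (Fin m) (Fin n) ℝ) (i : ℕ) :
    singularValue Xᵀ i = singularValue X i := by
  rw [singularValue, ← Matrix.conjTranspose_eq_transpose_of_trivial,
    Matrix.toEuclideanLin_conjTranspose_eq_adjoint, LinearMap.singularValues_adjoint, singularValue]

theorem prod_singularValue_mul_transpose_le (U : Matrix (Fin m) (Fin d) ℝ)
    (V : Matrix (Fin n) (Fin d) ℝ) (k : ℕ) :
    ∏ i ∈ Finset.range k, singularValue (U * Vᵀ) i ≤
      ∏ i ∈ Finset.range k, singularValue U i * singularValue V i := by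
  have hcomp : Matrix.toEuclideanLin (U * Vᵀ) =
      Matrix.toEuclideanLin U ∘ₗ Matrix.toEuclideanLin Vᵀ :=
    Matrix.toLpLin_mul_same 2 U Vᵀ
  have h := LinearMap.prod_singularValues_comp_le (Matrix.toEuclideanLin Vᵀ)
    (Matrix.toEuclideanLin U) k
  rw [← hcomp] at h
  exact h.trans_eq (Finset.prod_congr rfl fun i _ => by
    rw [← singularValue_transpose V]; rfl)

theorem inner_toEuclideanLin_basisFun (U : Matrix (Fin m) (Fin d) ℝ) (i j : Fin d) :
    inner ℝ (Matrix.toEuclideanLin U (EuclideanSpace.basisFun (Fin d) ℝ i))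
      (Matrix.toEuclideanLin U (EuclideanSpace.basisFun (Fin d) ℝ j)) = (Uᵀ * U) i j := by
  simp [Matrix.mul_apply, PiLp.inner_apply, mul_comm]

/-- If the columns of `U` are orthogonal with nonincreasing norms `s i`, then these norms are its
singular values. -/
theorem singularValue_eq_of_transpose_mul_self {U : Matrix (Fin m) (Fin d) ℝ} {s : ℕ → ℝ}
    (hs : Antitone s) (hs0 : ∀ i, 0 ≤ s i)
    (h : Uᵀ * U = Matrix.diagonal fun i : Fin d => s i ^ 2) {i : ℕ} (hi : i < d) :
    singularValue U i = s i := by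
  refine LinearMap.IsSingularBasis.eq_singularValues (b := EuclideanSpace.basisFun (Fin d) ℝ)
    ⟨fun i j hij => hs hij, fun i => hs0 i, fun i j => ?_⟩ hi
  rw [inner_toEuclideanLin_basisFun, h, Matrix.diagonal_apply]

theorem sum_singularValue_rpow_eq (X : Matrix (Fin m) (Fin n) ℝ) (hX : X.rank ≤ d) {p : ℝ}
    (hp : p ≠ 0) : ∑ i ∈ Finset.range d, singularValue X i ^ p =
      ∑ i ∈ Finset.range X.rank, singularValue X i ^ p := by
  symm
  refine Finset.sum_subset (Finset.range_mono hX) fun i _ hi => ?_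
  rw [(singularValue_eq_zero_iff X).2 (by simpa using hi), Real.zero_rpow hp]

/-- Any number `d ≥ rank X` of terms gives the same Schatten norm, since the other singular values
vanish. -/
theorem schattenNorm_eq (X : Matrix (Fin m) (Fin n) ℝ) {p : ℝ} (hp : p ≠ 0) (hX : X.rank ≤ d) :
    schattenNorm p X = (∑ i ∈ Finset.range d, singularValue X i ^ p) ^ (1 / p) := by
  rw [schattenNorm, sum_singularValue_rpow_eq X X.rank_le_width hp,
    sum_singularValue_rpow_eq X hX hp]

/-- Hölder's inequality for Schatten quasi-norms. -/
theorem schattenNorm_mul_transpose_le {p p₁ p₂ : ℝ} (hp : 0 < p) (hp₁ : 0 < p₁) (hp₂ : 0 < p₂)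
    (hsum : 1 / p₁ + 1 / p₂ = 1 / p) (U : Matrix (Fin m) (Fin d) ℝ)
    (V : Matrix (Fin n) (Fin d) ℝ) :
    schattenNorm p (U * Vᵀ) ≤ schattenNorm p₁ U * schattenNorm p₂ V := by
  have hrank : (U * Vᵀ).rank ≤ d := (Matrix.rank_mul_le_left U Vᵀ).trans U.rank_le_width
  have hnn : ∀ i, 0 ≤ singularValue U i * singularValue V i := fun i =>
    mul_nonneg (singularValue_nonneg U i) (singularValue_nonneg V i)
  have h1 : ∑ i ∈ Finset.range (U * Vᵀ).rank, singularValue (U * Vᵀ) i ^ p ≤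
      ∑ i ∈ Finset.range d, (singularValue U i * singularValue V i) ^ p :=
    (sum_rpow_le_sum_rpow_of_prod_le hp (singularValue_antitone _) (singularValue_nonneg _)
      (fun i hi => (singularValue_pos_iff _).2 hi) hnn
      fun k _ => prod_singularValue_mul_transpose_le U V k).trans
    (Finset.sum_le_sum_of_subset_of_nonneg (Finset.range_mono hrank)
      fun i _ _ => Real.rpow_nonneg (hnn i) p)
  have hpqr : Real.HolderTriple p₁ p₂ p := ⟨by simpa using hsum, hp₁, hp₂⟩
  have h2 := Real.Lr_rpow_le_Lp_mul_Lq (Finset.range d) (singularValue U) (singularValue V) hpqr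
  simp only [abs_of_nonneg (hnn _), abs_of_nonneg (singularValue_nonneg U _),
    abs_of_nonneg (singularValue_nonneg V _)] at h2
  have hU := Finset.sum_nonneg fun i (_ : i ∈ Finset.range d) =>
    Real.rpow_nonneg (singularValue_nonneg U i) p₁
  have hV := Finset.sum_nonneg fun i (_ : i ∈ Finset.range d) =>
    Real.rpow_nonneg (singularValue_nonneg V i) p₂
  rw [schattenNorm_eq _ hp.ne' le_rfl]
  refine (Real.rpow_le_rpow (Finset.sum_nonneg fun i _ =>
    Real.rpow_nonneg (singularValue_nonneg _ i) p) (h1.trans h2) (by positivity)).trans_eq ?_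
  rw [Real.mul_rpow (by positivity) (by positivity), ← Real.rpow_mul hU, ← Real.rpow_mul hV,
    schattenNorm, schattenNorm]
  congr 2 <;> field_simp

/-! ### Factorizations from a truncated singular value decomposition -/

theorem IsTruncatedSVD.rank_le {X : Matrix (Fin m) (Fin n) ℝ} {L : Matrix (Fin m) (Fin d) ℝ}
    {R : Matrix (Fin n) (Fin d) ℝ} (h : IsTruncatedSVD X L R) : X.rank ≤ d := by
  rw [h.eq_mul]
  exact (Matrix.rank_mul_le_left _ _).trans (Matrix.rank_le_width _)

theorem transpose_mul_self_mul_sigmaPow (X : Matrix (Fin m) (Fin n) ℝ) {k : ℕ}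
    {L : Matrix (Fin k) (Fin d) ℝ} (hL : ∀ i j : Fin d, (i : ℕ) < X.rank → (j : ℕ) < X.rank →
      (Lᵀ * L) i j = if i = j then 1 else 0) {q : ℝ} (hq : 0 < q) :
    (L * sigmaPow d X q)ᵀ * (L * sigmaPow d X q) =
      Matrix.diagonal fun i : Fin d => (singularValue X i ^ q) ^ 2 := by
  have hzero : ∀ i : Fin d, ¬ (i : ℕ) < X.rank → singularValue X i ^ q = 0 := fun i hi => by
    rw [(singularValue_eq_zero_iff X).2 (not_lt.1 hi), Real.zero_rpow hq.ne']
  ext i j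
  rw [Matrix.transpose_mul, sigmaPow, Matrix.diagonal_transpose, Matrix.mul_assoc,
    Matrix.diagonal_mul, ← Matrix.mul_assoc, Matrix.mul_diagonal, Matrix.diagonal_apply]
  by_cases hi : (i : ℕ) < X.rank
  · by_cases hj : (j : ℕ) < X.rank
    · rw [hL i j hi hj]
      split_ifs with hij
      · rw [hij]; ring
      · ring
    · have hij : i ≠ j := fun h => hj (h ▸ hi)
      rw [hzero j hj, if_neg hij]
      ring
  · rw [hzero i hi]
    split_ifs <;> ring

theorem schattenNorm_mul_sigmaPow (X : Matrix (Fin m) (Fin n) ℝ) {k : ℕ}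
    {L : Matrix (Fin k) (Fin d) ℝ} (hL : ∀ i j : Fin d, (i : ℕ) < X.rank → (j : ℕ) < X.rank →
      (Lᵀ * L) i j = if i = j then 1 else 0) {p q : ℝ} (hp : 0 < p) (hq : 0 < q) :
    schattenNorm q (L * sigmaPow d X (p / q)) =
      (∑ i ∈ Finset.range d, singularValue X i ^ p) ^ (1 / q) := by
  rw [schattenNorm]
  congr 1
  refine Finset.sum_congr rfl fun i hi => ?_
  rw [singularValue_eq_of_transpose_mul_self (s := fun i => singularValue X i ^ (p / q))
    (fun i j hij => Real.rpow_le_rpow (singularValue_nonneg X j) (singularValue_antitone X hij)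
      (by positivity)) (fun i => Real.rpow_nonneg (singularValue_nonneg X i) _)
    (transpose_mul_self_mul_sigmaPow X hL (by positivity)) (Finset.mem_range.1 hi),
    ← Real.rpow_mul (singularValue_nonneg X i), div_mul_cancel₀ _ hq.ne']

theorem IsTruncatedSVD.schattenNorm_eq_mul {X : Matrix (Fin m) (Fin n) ℝ}
    {L : Matrix (Fin m) (Fin d) ℝ} {R : Matrix (Fin n) (Fin d) ℝ} (h : IsTruncatedSVD X L R)
    {p p₁ p₂ : ℝ} (hp : 0 < p) (hp₁ : 0 < p₁) (hp₂ : 0 < p₂) (hsum : 1 / p₁ + 1 / p₂ = 1 / p) :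
    schattenNorm p X = schattenNorm p₁ (L * sigmaPow d X (p / p₁)) *
      schattenNorm p₂ (R * sigmaPow d X (p / p₂)) := by
  rw [schattenNorm_eq X hp.ne' h.rank_le, schattenNorm_mul_sigmaPow X h.left_orthonormal hp hp₁,
    schattenNorm_mul_sigmaPow X h.right_orthonormal hp hp₂, ← hsum,
    Real.rpow_add_of_nonneg (Finset.sum_nonneg fun i _ =>
      Real.rpow_nonneg (singularValue_nonneg X i) p) (by positivity) (by positivity)]

theorem IsTruncatedSVD.eq_mul_transpose {X : Matrix (Fin m) (Fin n) ℝ}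
    {L : Matrix (Fin m) (Fin d) ℝ} {R : Matrix (Fin n) (Fin d) ℝ} (h : IsTruncatedSVD X L R)
    {a b : ℝ} (ha : 0 < a) (hb : 0 < b) (hab : a + b = 1) :
    X = (L * sigmaPow d X a) * (R * sigmaPow d X b)ᵀ := by
  have hpow : (fun i : Fin d => singularValue X i) =
      fun i : Fin d => singularValue X i ^ a * singularValue X i ^ b := by
    funext i
    rw [← Real.rpow_add_of_nonneg (singularValue_nonneg X i) ha.le hb.le, hab, Real.rpow_one]
  conv_lhs => rw [h.eq_mul, hpow]
  rw [sigmaPow, sigmaPow, Matrix.transpose_mul, Matrix.diagonal_transpose,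
    ← Matrix.diagonal_mul_diagonal]
  simp only [Matrix.mul_assoc]

/-! ### Existence of truncated singular value decompositions -/

/-- A full singular value decomposition. The indices of the two bases range over different types,
so `X v_j = σ_j u_j` is stated for `j < m`; the second clause covers `m ≤ j`, as `rank X ≤ m`. -/
theorem exists_orthonormalBasis_toEuclideanLin_eq_smul (X : Matrix (Fin m) (Fin n) ℝ) :
    ∃ (u : OrthonormalBasis (Fin m) ℝ (EuclideanSpace ℝ (Fin m)))
      (v : OrthonormalBasis (Fin n) ℝ (EuclideanSpace ℝ (Fin n))),
      ∀ (j : Fin n), (∀ hj : (j : ℕ) < m,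
        Matrix.toEuclideanLin X (v j) = singularValue X j • u ⟨j, hj⟩) ∧
        (X.rank ≤ j → Matrix.toEuclideanLin X (v j) = 0) := by
  obtain ⟨v, hv⟩ := (Matrix.toEuclideanLin X).exists_isSingularBasis finrank_euclideanSpace_fin
  have hrn : X.rank ≤ n := X.rank_le_width
  have hker : ∀ j : Fin n, X.rank ≤ j → Matrix.toEuclideanLin X (v j) = 0 := by
    intro j hj
    have := hv.inner_apply j j
    have h0 : (Matrix.toEuclideanLin X).singularValues j = 0 := (singularValue_eq_zero_iff X).2 hj
    rw [if_pos rfl, h0] at this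
    simpa using this
  -- The normalised images `X v_i / σ_i`; only those with index below the rank are used.
  let w : Fin m → EuclideanSpace ℝ (Fin m) := fun i =>
    if h : (i : ℕ) < n then (singularValue X i)⁻¹ • Matrix.toEuclideanLin X (v ⟨i, h⟩) else 0
  have hw : ∀ (i : Fin m) (h : (i : ℕ) < n),
      w i = (singularValue X i)⁻¹ • Matrix.toEuclideanLin X (v ⟨i, h⟩) := fun i h => dif_pos h
  have horth : Orthonormal ℝ (({i | (i : ℕ) < X.rank} : Set (Fin m)).domRestrict w) := by
    rw [orthonormal_iff_ite]
    rintro ⟨i, hi⟩ ⟨j, hj⟩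
    have hi' : (i : ℕ) < X.rank := hi
    have hj' : (j : ℕ) < X.rank := hj
    simp only [Set.domRestrict_apply, hw i (hi'.trans_le hrn), hw j (hj'.trans_le hrn),
      inner_smul_left, inner_smul_right, hv.inner_apply, Subtype.mk.injEq, Fin.mk.injEq,
      Fin.val_inj]
    split_ifs with hij
    · have := ((singularValue_pos_iff X).2 hi').ne'
      subst hij
      change (singularValue X i)⁻¹ * ((singularValue X i)⁻¹ * singularValue X i ^ 2) = 1
      field_simp
    · simp
  obtain ⟨u, hu⟩ := horth.exists_orthonormalBasis_extension_of_card_eq (by simp)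
  refine ⟨u, v, fun j => ⟨fun hj => ?_, hker j⟩⟩
  rcases lt_or_ge (j : ℕ) X.rank with hjr | hjr
  · rw [hu ⟨j, hj⟩ hjr, hw ⟨j, hj⟩ j.2, smul_inv_smul₀ ((singularValue_pos_iff X).2 hjr).ne']
  · rw [hker j hjr, (singularValue_eq_zero_iff X).2 hjr, zero_smul]

/-- The matrix whose `j`-th column is `u j` for `j < k`, and `0` for `j ≥ k`; so `d` may exceed the
dimension `k`. -/
def leadingColumns (d : ℕ) {k : ℕ} (u : OrthonormalBasis (Fin k) ℝ (EuclideanSpace ℝ (Fin k))) :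
    Matrix (Fin k) (Fin d) ℝ :=
  Matrix.of fun i j => if h : (j : ℕ) < k then u ⟨j, h⟩ i else 0

theorem leadingColumns_transpose_mul_self {k : ℕ}
    (u : OrthonormalBasis (Fin k) ℝ (EuclideanSpace ℝ (Fin k))) {i j : Fin d} (hi : (i : ℕ) < k)
    (hj : (j : ℕ) < k) :
    ((leadingColumns d u)ᵀ * leadingColumns d u) i j = if i = j then 1 else 0 := by
  have := u.inner_eq_ite ⟨j, hj⟩ ⟨i, hi⟩
  simp only [Fin.mk.injEq, Fin.val_inj, PiLp.inner_apply] at this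
  simp only [Matrix.mul_apply, Matrix.transpose_apply, leadingColumns, Matrix.of_apply, hi, hj,
    dif_pos, eq_comm (a := i)]
  simpa using this

theorem exists_isTruncatedSVD (X : Matrix (Fin m) (Fin n) ℝ) (hX : X.rank ≤ d) :
    ∃ (L : Matrix (Fin m) (Fin d) ℝ) (R : Matrix (Fin n) (Fin d) ℝ),
      IsTruncatedSVD X L R ∧ (d ≤ min m n → Lᵀ * L = 1 ∧ Rᵀ * R = 1) := by
  obtain ⟨u, v, huv⟩ := exists_orthonormalBasis_toEuclideanLin_eq_smul X
  refine ⟨leadingColumns d u, leadingColumns d v, ⟨?_, fun i j hi hj => ?_, fun i j hi hj => ?_⟩,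
    fun hd => ⟨?_, ?_⟩⟩
  · -- It suffices to compare the two sides on the basis `v`.
    apply Matrix.toEuclideanLin.injective
    refine v.toBasis.ext fun j => ?_
    have hR : (leadingColumns d v)ᵀ *ᵥ v j = fun k : Fin d => if (k : ℕ) = j then 1 else 0 := by
      funext k
      rcases lt_or_ge (k : ℕ) n with hk | hk
      · have := v.inner_eq_ite ⟨k, hk⟩ j
        simp only [Fin.ext_iff] at this
        rw [← this]
        simp [Matrix.mulVec, dotProduct, leadingColumns, hk, PiLp.inner_apply, mul_comm]
      · have hkj : (k : ℕ) ≠ j := (j.2.trans_le hk).ne'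
        simp [Matrix.mulVec, dotProduct, leadingColumns, hk.not_gt, hkj]
    ext i
    rw [OrthonormalBasis.coe_toBasis, Matrix.ofLp_toLpLin 2 2 (leadingColumns d u * _ * _),
      Matrix.toLin'_apply, ← Matrix.mulVec_mulVec, hR]
    rcases lt_or_ge (j : ℕ) X.rank with hj | hj
    · have hjm : (j : ℕ) < m := hj.trans_le X.rank_le_height
      have hjd : (j : ℕ) < d := hj.trans_le hX
      have hsingle : (fun k : Fin d => if (k : ℕ) = j then (1 : ℝ) else 0) =
          Pi.single ⟨j, hjd⟩ 1 := by
        funext k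
        simp [Pi.single_apply, Fin.ext_iff]
      rw [(huv j).1 hjm, hsingle, Matrix.mulVec_single_one, Matrix.col_apply,
        Matrix.mul_diagonal]
      simp [leadingColumns, hjm, mul_comm]
    · rw [(huv j).2 hj, ← Matrix.mulVec_mulVec]
      have hz : (Matrix.diagonal fun i : Fin d => singularValue X i) *ᵥ
          (fun k : Fin d => if (k : ℕ) = j then (1 : ℝ) else 0) = 0 := by
        funext k
        rw [Matrix.mulVec_diagonal]
        split_ifs with hk
        · rw [hk, (singularValue_eq_zero_iff X).2 hj]
          simp
        · simp
      simp [hz]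
  · exact leadingColumns_transpose_mul_self u (hi.trans_le X.rank_le_height)
      (hj.trans_le X.rank_le_height)
  · exact leadingColumns_transpose_mul_self v (hi.trans_le X.rank_le_width)
      (hj.trans_le X.rank_le_width)
  · ext i j
    rw [leadingColumns_transpose_mul_self u (i.2.trans_le (hd.trans (min_le_left _ _)))
      (j.2.trans_le (hd.trans (min_le_left _ _))), Matrix.one_apply]
  · ext i j
    rw [leadingColumns_transpose_mul_self v (i.2.trans_le (hd.trans (min_le_right _ _)))
      (j.2.trans_le (hd.trans (min_le_right _ _))), Matrix.one_apply]

end SchattenFactorization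

end

theorem theorem1 {m n d : ℕ} (X : Matrix (Fin m) (Fin n) ℝ) (hX : X.rank ≤ d)
    (p p₁ p₂ : ℝ) (hp : 0 < p) (hp_le : p ≤ 1) (hp₁ : 0 < p₁) (hp₂ : 0 < p₂)
    (hsum : 1 / p₁ + 1 / p₂ = 1 / p) :
    -- the Schatten quasi-norm of `X` is the minimum over all factorizations
    IsLeast {c : ℝ | ∃ (U : Matrix (Fin m) (Fin d) ℝ) (V : Matrix (Fin n) (Fin d) ℝ),
        X = U * Vᵀ ∧
          c = SchattenFactorization.schattenNorm p₁ U * SchattenFactorization.schattenNorm p₂ V}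
      (SchattenFactorization.schattenNorm p X) ∧
    -- a truncated singular value decomposition exists
    (∃ (L : Matrix (Fin m) (Fin d) ℝ) (R : Matrix (Fin n) (Fin d) ℝ),
      SchattenFactorization.IsTruncatedSVD X L R ∧
        (d ≤ min m n → Lᵀ * L = 1 ∧ Rᵀ * R = 1)) ∧
    -- and every one of them gives a minimizer
    (∀ (L : Matrix (Fin m) (Fin d) ℝ) (R : Matrix (Fin n) (Fin d) ℝ),
      SchattenFactorization.IsTruncatedSVD X L R →
        X = (L * SchattenFactorization.sigmaPow d X (p / p₁)) *
              (R * SchattenFactorization.sigmaPow d X (p / p₂))ᵀ ∧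
        SchattenFactorization.schattenNorm p X =
          SchattenFactorization.schattenNorm p₁
              (L * SchattenFactorization.sigmaPow d X (p / p₁)) *
            SchattenFactorization.schattenNorm p₂
              (R * SchattenFactorization.sigmaPow d X (p / p₂))) := by
  have hminimizer : ∀ (L : Matrix (Fin m) (Fin d) ℝ) (R : Matrix (Fin n) (Fin d) ℝ),
      SchattenFactorization.IsTruncatedSVD X L R →
        X = (L * SchattenFactorization.sigmaPow d X (p / p₁)) *
              (R * SchattenFactorization.sigmaPow d X (p / p₂))ᵀ ∧
        SchattenFactorization.schattenNorm p X =
          SchattenFactorization.schattenNorm p₁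
              (L * SchattenFactorization.sigmaPow d X (p / p₁)) *
            SchattenFactorization.schattenNorm p₂
              (R * SchattenFactorization.sigmaPow d X (p / p₂)) := fun L R h =>
    ⟨h.eq_mul_transpose (div_pos hp hp₁) (div_pos hp hp₂) (by
        rw [div_eq_mul_one_div, div_eq_mul_one_div p p₂, ← mul_add, hsum,
          mul_one_div_cancel hp.ne']),
      h.schattenNorm_eq_mul hp hp₁ hp₂ hsum⟩
  have hsvd := SchattenFactorization.exists_isTruncatedSVD X hX
  refine ⟨⟨?_, ?_⟩, hsvd, hminimizer⟩
  · obtain ⟨L, R, h, -⟩ := hsvd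
    exact ⟨_, _, hminimizer L R h⟩
  · rintro _ ⟨U, V, rfl, rfl⟩
    exact SchattenFactorization.schattenNorm_mul_transpose_le hp hp₁ hp₂ hsum U V
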